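/- Let $G$ be a countably infinite discrete group acting in a Borel way on a standard Borel space $X$, freely (i.e. $g\cdot x\neq x$ for all $x\in X$ and all $g\neq 1_G$), and preserving a Borel probability measure $\mu$ on $X$. Then for every $\varepsilon>0$ there exist a standard Borel space $Z$ with a free Borel action of $G$, a $G$-invariant Borel probability measure $\eta$ on $Z$, and a factor map $f:(X,\mu)\to(Z,\eta)$ (a Borel map with $f(g\cdot x)=g\cdot f(x)$ for all $g\in G$, $x\in X$, and $f_*\mu=\eta$), such that $G\curvearrowright(Z,\eta)$ admits a generating partition $\{C_0,C_1\}$ with exactly two pieces whose Shannon entropy satisfies $$H_\eta(\{C_0,C_1\})=-\sum_{i\in\{0,1\}}\eta(C_i)\log\eta(C_i)<\varepsilon .$$ Here a partition $\{C_0,C_1\}$ of $Z$ into nonempty Borel sets is called generating for $G\curvearrowright(Z,\eta)$ if there is a $G$-invariant $\eta$-conull Borel set $Z_0\subseteq Z$ such that the smallest $G$-invariant $\sigma$-algebra on $Z_0$ containing $C_0\cap Z_0$ and $C_1\cap Z_0$ is the whole Borel $\sigma$-algebra of $Z_0$. -/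

import Mathlib

open MeasureTheory

universe u v

/-- A probability-measure-preserving (p.m.p.) Borel action of the discrete group `G` on the
standard Borel probability space `(X, μ)`. -/
structure IsPMPAction (G : Type*) {X : Type*} [Group G] [MulAction G X] [MeasurableSpace X]
    (μ : Measure X) : Prop where
  standardBorel : StandardBorelSpace X
  measurable_smul : ∀ g : G, Measurable fun x : X => g • x
  isProbabilityMeasure : IsProbabilityMeasure μ
  measure_preserving : ∀ g : G, MeasurePreserving (fun x : X => g • x) μ μ

/-- The action of `G` on `X` is free: every point has trivial stabilizer. -/
def IsFreeAction (G X : Type*) [Group G] [MulAction G X] : Prop :=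
  ∀ (g : G) (x : X), g • x = x → g = 1

/-- A factor map from `(X, μ)` onto `(Z, η)`: a Borel `G`-equivariant map pushing `μ` forward
to `η`. -/
structure IsFactorMap (G : Type*) {X Z : Type*} [Group G] [MulAction G X] [MulAction G Z]
    [MeasurableSpace X] [MeasurableSpace Z] (μ : Measure X) (η : Measure Z) (f : X → Z) :
    Prop where
  measurable : Measurable f
  equivariant : ∀ (g : G) (x : X), f (g • x) = g • f x
  map_eq : Measure.map f μ = η

/-- A countable Borel partition of `X`; its pieces are nonempty. -/
structure IsCountableBorelPartition {X : Type*} [MeasurableSpace X] (P : Set (Set X)) :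
    Prop where
  countable : P.Countable
  measurableSet : ∀ A ∈ P, MeasurableSet A
  isPartition : Setoid.IsPartition P

/-- The smallest `G`-invariant σ-algebra on `X` containing all members of `P`. -/
@[reducible]
def invariantSigmaAlgebra (G : Type*) {X : Type*} [Group G] [MulAction G X]
    (P : Set (Set X)) : MeasurableSpace X :=
  sInf {m : MeasurableSpace X | (∀ A ∈ P, MeasurableSet[m] A) ∧
    ∀ (g : G) (A : Set X), MeasurableSet[m] A → MeasurableSet[m] ((fun x => g • x) ⁻¹' A)}

/-- `P` is a generating partition for the Borel action of `G` on `X`. -/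
structure IsGeneratingPartition (G : Type*) {X : Type*} [Group G] [MulAction G X]
    [mX : MeasurableSpace X] (P : Set (Set X)) : Prop where
  isCountableBorelPartition : IsCountableBorelPartition P
  generates : invariantSigmaAlgebra G P = mX

/-- The partition induced on the subset `S` by the partition `P`: the nonempty traces on `S` of
the pieces of `P`. -/
def restrictPartition {X : Type*} (P : Set (Set X)) (S : Set X) : Set (Set S) :=
  {B | B.Nonempty ∧ ∃ A ∈ P, B = Subtype.val ⁻¹' A}

/-- `P` is a generating partition for the action of `G` on `(X, μ)`: it is a countable Borel
partition of `X`, and for some conull `G`-invariant Borel set `X₀` it induces a generating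
partition for the action of `G` on `X₀`. -/
structure IsMeasureGeneratingPartition (G : Type*) {X : Type*} [Group G] [MulAction G X]
    [MeasurableSpace X] (μ : Measure X) (P : Set (Set X)) : Prop where
  isCountableBorelPartition : IsCountableBorelPartition P
  generates : ∃ X₀ : SubMulAction G X, MeasurableSet (X₀ : Set X) ∧ μ (X₀ : Set X)ᶜ = 0 ∧
    IsGeneratingPartition G (X := X₀) (restrictPartition P (X₀ : Set X))

/-- The Shannon entropy `-∑ μ(A) log μ(A)` (natural logarithm, `0 log 0 = 0`) of the countable
partition `P` of a probability space. All summands are nonnegative, so the sum is taken in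
`[0, ∞]`. -/
noncomputable def shannonEntropy {X : Type*} [MeasurableSpace X] (μ : Measure X)
    (P : Set (Set X)) : ENNReal :=
  ∑' A : P, ENNReal.ofReal (Real.negMulLog (μ.real (A : Set X)))

open scoped symmDiff ENNReal Topology
open Filter

/-! ### Completeness of the measure algebra -/

namespace MeasureTheory.MeasuredSets

variable {X : Type*} [MeasurableSpace X] {μ : Measure X}

/-- The measurable sets modulo null sets form a complete space. -/
instance completeSpace : CompleteSpace (MeasuredSets μ) := by
  refine EMetric.complete_of_convergent_controlled_sequences (fun n => 2⁻¹ ^ n)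
    (fun n => ENNReal.pow_pos (by simp) n) fun s hs => ?_
  let L : MeasuredSets μ := ⟨limsup (fun n => (s n : Set X)) atTop,
    MeasurableSet.measurableSet_limsup fun n => (s n).2⟩
  refine ⟨L, ?_⟩
  have key : ∀ n, edist (s n) L ≤ 2⁻¹ ^ n * 2 := by
    intro n
    -- A point in none of the later consecutive differences has constant membership from `n` on,
    -- hence the same membership in the limsup.
    have hsub : ((s n : Set X) ∆ (L : Set X)) ⊆
        ⋃ k : ℕ, ((s (n + k) : Set X) ∆ (s (n + k + 1) : Set X)) := by
      intro x hx
      by_contra hcon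
      simp only [Set.mem_iUnion, not_exists] at hcon
      have hconst : ∀ k, x ∈ (s (n + k) : Set X) ↔ x ∈ (s n : Set X) := by
        intro k
        induction k with
        | zero => rfl
        | succ k ih =>
          have := hcon k
          rw [Set.mem_symmDiff] at this
          rw [← ih, ← add_assoc]
          tauto
      have hL : x ∈ (L : Set X) ↔ x ∈ (s n : Set X) := by
        change x ∈ limsup (fun n => (s n : Set X)) atTop ↔ _
        rw [mem_limsup_iff_frequently_mem]
        constructor
        · intro h
          obtain ⟨m, hm, hxm⟩ := (h.and_eventually (eventually_ge_atTop n)).exists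
          obtain ⟨k, rfl⟩ := Nat.exists_eq_add_of_le hxm
          exact (hconst k).1 hm
        · intro h
          refine Eventually.frequently ?_
          filter_upwards [eventually_ge_atTop n] with m hm
          obtain ⟨k, rfl⟩ := Nat.exists_eq_add_of_le hm
          exact (hconst k).2 h
      rw [Set.mem_symmDiff] at hx
      tauto
    calc edist (s n) L = μ ((s n : Set X) ∆ (L : Set X)) := rfl
      _ ≤ ∑' k : ℕ, μ ((s (n + k) : Set X) ∆ (s (n + k + 1) : Set X)) :=
        (measure_mono hsub).trans (measure_iUnion_le _)
      _ ≤ ∑' k : ℕ, 2⁻¹ ^ n * 2⁻¹ ^ k := by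
        refine ENNReal.tsum_le_tsum fun k => ?_
        rw [← pow_add]
        exact (hs (n + k) (n + k) (n + k + 1) le_rfl (Nat.le_succ _)).le
      _ = 2⁻¹ ^ n * 2 := by
        rw [ENNReal.tsum_mul_left, ENNReal.tsum_geometric, ENNReal.one_sub_inv_two, inv_inv]
  rw [tendsto_iff_edist_tendsto_0]
  refine tendsto_of_tendsto_of_tendsto_of_le_of_le tendsto_const_nhds ?_ (fun _ => zero_le) key
  have h2 : Tendsto (fun n : ℕ => (2⁻¹ : ℝ≥0∞) ^ n * 2) atTop (𝓝 (0 * 2)) :=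
    ENNReal.Tendsto.mul_const
      (ENNReal.tendsto_pow_atTop_nhds_zero_of_lt_one (by simp)) (Or.inr (by simp))
  simpa using h2

end MeasureTheory.MeasuredSets

/-! ### Independence by counting labellings -/

section Counting

open Finset

/-- The labellings whose restriction along an injection `u` lies in `S` have the density of `S`. -/
theorem card_filter_comp_mem_mul {ι J α : Type*} [Fintype ι] [Fintype J] [Fintype α]
    [DecidableEq ι] [DecidableEq J] {u : J → ι} (hu : Function.Injective u)
    (S : Set (J → α)) [DecidablePred (· ∈ S)] :
    #{ω : ι → α | ω ∘ u ∈ S} * Fintype.card α ^ Fintype.card J =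
      #{σ : J → α | σ ∈ S} * Fintype.card α ^ Fintype.card ι := by
  classical
  let e : J ⊕ ((Set.range u)ᶜ : Set ι) ≃ ι :=
    ((Equiv.ofInjective u hu).sumCongr (Equiv.refl _)).trans (Equiv.Set.sumCompl (Set.range u))
  have he : ∀ j, e (Sum.inl j) = u j := fun j => rfl
  let Φ : (ι → α) ≃ (J → α) × (((Set.range u)ᶜ : Set ι) → α) :=
    (Equiv.arrowCongr e.symm (Equiv.refl α)).trans (Equiv.sumArrowEquivProdArrow _ _ _)
  have hΦ : ∀ ω, (Φ ω).1 = ω ∘ u := fun ω => rfl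
  have hcard : #{ω : ι → α | ω ∘ u ∈ S} =
      #(({σ : J → α | σ ∈ S} : Finset (J → α)) ×ˢ
        (univ : Finset (((Set.range u)ᶜ : Set ι) → α))) := by
    refine Finset.card_equiv Φ fun ω => ?_
    simp [hΦ]
  have hι : Fintype.card ι = Fintype.card J + Fintype.card ((Set.range u)ᶜ : Set ι) := by
    rw [← Fintype.card_sum, Fintype.card_congr e]
  rw [hcard, card_product, card_univ, Fintype.card_fun, hι, pow_add]
  ring

/-- Independent proper constraints on disjoint blocks of coordinates. -/
theorem card_filter_forall_mem_mul_le {ι F B α : Type*} [Fintype ι] [Fintype F] [Fintype B]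
    [Fintype α] [DecidableEq ι] {u : F × B → ι} (hu : Function.Injective u)
    (S : F → Set (B → α)) (hS : ∀ g, S g ≠ Set.univ)
    [DecidablePred fun ω : ι → α => ∀ g, (fun b => ω (u (g, b))) ∈ S g] :
    #{ω : ι → α | ∀ g, (fun b => ω (u (g, b))) ∈ S g} *
        (Fintype.card α ^ Fintype.card B) ^ Fintype.card F ≤
      (Fintype.card α ^ Fintype.card B - 1) ^ Fintype.card F *
        Fintype.card α ^ Fintype.card ι := by
  classical
  have h := card_filter_comp_mem_mul (α := α) hu {σ | ∀ g, (fun b => σ (g, b)) ∈ S g}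
  have hle : #{σ : F × B → α | σ ∈ {σ : F × B → α | ∀ g, (fun b => σ (g, b)) ∈ S g}} ≤
      (Fintype.card α ^ Fintype.card B - 1) ^ Fintype.card F := by
    have h1 : #{σ : F × B → α | σ ∈ {σ : F × B → α | ∀ g, (fun b => σ (g, b)) ∈ S g}} =
        #(Fintype.piFinset fun g => ({τ : B → α | τ ∈ S g} : Finset (B → α))) := by
      refine Finset.card_equiv (Equiv.curry F B α) fun σ => ?_
      simp only [Fintype.mem_piFinset, mem_filter, mem_univ, true_and, Set.mem_ofPred_eq]
      rfl
    rw [h1, Fintype.card_piFinset, ← card_univ (α := F)]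
    refine prod_le_pow_card _ _ _ fun g _ => ?_
    obtain ⟨τ, hτ⟩ := (Set.ne_univ_iff_exists_notMem _).1 (hS g)
    rw [← Fintype.card_fun, ← card_univ, ← card_erase_of_mem (mem_univ τ)]
    refine card_le_card fun τ' hτ' => ?_
    rw [mem_filter] at hτ'
    refine mem_erase.2 ⟨fun h => hτ (h ▸ hτ'.2), mem_univ _⟩
  rw [Fintype.card_prod, mul_comm (Fintype.card F), pow_mul] at h
  refine (le_of_eq ?_).trans (h.le.trans (Nat.mul_le_mul_right _ hle))
  congr!

end Counting

/-! ### Averaging, and finite sets disjoint from a translate -/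

/-- Averaging: if all points outside `E` lie in at most `c` of the sets `S ω`, then the total
measure of the sets is at most `c`, up to the contribution of `E`. -/
theorem sum_measureReal_le_of_card_le {X Ω : Type*} [MeasurableSpace X] (μ : Measure X)
    [IsProbabilityMeasure μ] [Fintype Ω] {S : Ω → Set X} (hS : ∀ ω, MeasurableSet (S ω))
    {E : Set X} (hE : MeasurableSet E) {c : ℝ} (hc : 0 ≤ c)
    (h : ∀ x ∉ E, (Nat.card {ω | x ∈ S ω} : ℝ) ≤ c) :
    ∑ ω, μ.real (S ω) ≤ c + Fintype.card Ω * μ.real E := by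
  classical
  have hSE : ∀ ω, MeasurableSet (S ω \ E) := fun ω => (hS ω).diff hE
  have h1 : ∑ ω, μ.real (S ω \ E) ≤ c := by
    have hint : ∀ ω ∈ (Finset.univ : Finset Ω),
        Integrable ((S ω \ E).indicator (1 : X → ℝ)) μ :=
      fun ω _ => (integrable_const (1 : ℝ)).indicator (hSE ω)
    calc ∑ ω, μ.real (S ω \ E) = ∑ ω, ∫ x, (S ω \ E).indicator (1 : X → ℝ) x ∂μ :=
          Finset.sum_congr rfl fun ω _ => (integral_indicator_one (hSE ω)).symm
      _ = ∫ x, ∑ ω, (S ω \ E).indicator (1 : X → ℝ) x ∂μ := (integral_finsetSum _ hint).symm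
      _ ≤ ∫ _, c ∂μ := by
        refine integral_mono (integrable_finsetSum _ hint) (integrable_const c) fun x => ?_
        by_cases hx : x ∈ E
        · simpa [hx] using hc
        · refine le_trans (le_of_eq ?_) (h x hx)
          simp [Set.indicator_apply, hx, Fintype.card_subtype]
      _ = c := by simp
  calc ∑ ω, μ.real (S ω) ≤ ∑ ω, (μ.real (S ω \ E) + μ.real E) := by
        refine Finset.sum_le_sum fun ω _ => ?_
        exact (measureReal_mono (by intro x hx; by_cases x ∈ E <;> simp_all)).trans
          (measureReal_union_le _ _)
    _ ≤ c + Fintype.card Ω * μ.real E := by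
        rw [Finset.sum_add_distrib]
        simpa using h1

/-- In an infinite group there are arbitrarily large finite sets disjoint from their translate by a
given nontrivial element. -/
theorem exists_finset_card_eq_forall_ne_mul {G : Type*} [Group G] [Infinite G] {h : G}
    (hh : h ≠ 1) (M : ℕ) : ∃ F : Finset G, F.card = M ∧ ∀ a ∈ F, ∀ b ∈ F, a ≠ b * h := by
  classical
  induction M with
  | zero => exact ⟨∅, by simp⟩
  | succ M ih =>
    obtain ⟨F, hF, hd⟩ := ih
    obtain ⟨g, hg⟩ := Infinite.exists_notMem_finset
      (F ∪ F.image (· * h) ∪ F.image (· * h⁻¹))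
    simp only [Finset.mem_union, Finset.mem_image, not_or, not_exists, not_and] at hg
    refine ⟨insert g F, by rw [Finset.card_insert_of_notMem hg.1.1, hF], ?_⟩
    intro a ha b hb hab
    rcases Finset.mem_insert.1 ha with rfl | ha <;> rcases Finset.mem_insert.1 hb with rfl | hb
    · exact hh (by simpa using hab)
    · exact hg.1.2 b hb hab.symm
    · exact hg.2 a ‹a ∈ F› (by simp [hab])
    · exact hd a ha b hb hab

/-! ### Agreement sets and openness -/

section Agreement

variable {G : Type u} [Group G] {X : Type v} [MulAction G X]

/-- The points `x` such that `A` does not distinguish `g • x` from `g • h • x` for `g ∈ F`. -/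
def agreementSet (F : Set G) (h : G) (A : Set X) : Set X :=
  {x | ∀ g ∈ F, g • x ∈ A ↔ (g * h) • x ∈ A}

variable [MeasurableSpace X] {μ : Measure X}

theorem measurableSet_agreementSet [Countable G] (hμ : IsPMPAction G μ) (F : Set G) (h : G)
    {A : Set X} (hA : MeasurableSet A) : MeasurableSet (agreementSet F h A) := by
  have : agreementSet F h A = ⋂ g ∈ F, {x | g • x ∈ A ↔ (g * h) • x ∈ A} := by
    ext x; simp [agreementSet]
  rw [this]
  refine MeasurableSet.biInter (Set.to_countable F) fun g _ => ?_
  exact (hμ.measurable_smul g hA).iff (hμ.measurable_smul (g * h) hA)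

/-- Replacing `A` by `B` matters at `x` only if one of the `2|F|` points `g • x`, `(g * h) • x` lies
in `A ∆ B`; invariance of `μ` gives each event the same measure. -/
theorem measure_agreementSet_le (hμ : IsPMPAction G μ) (F : Finset G) (h : G)
    (A B : MeasuredSets μ) :
    μ (agreementSet (F : Set G) h (A : Set X)) ≤
      μ (agreementSet (F : Set G) h (B : Set X)) + (2 * F.card : ℕ) * edist A B := by
  have hD : MeasurableSet ((A : Set X) ∆ (B : Set X)) := A.2.symmDiff B.2
  have hpre : ∀ g : G, μ ((fun x => g • x) ⁻¹' ((A : Set X) ∆ (B : Set X))) = edist A B :=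
    fun g => (hμ.measure_preserving g).measure_preimage hD.nullMeasurableSet
  have hsub : agreementSet (F : Set G) h (A : Set X) ⊆
      agreementSet (F : Set G) h (B : Set X) ∪
        ⋃ g ∈ F, ((fun x => g • x) ⁻¹' ((A : Set X) ∆ (B : Set X)) ∪
          (fun x => (g * h) • x) ⁻¹' ((A : Set X) ∆ (B : Set X))) := by
    intro x hx
    by_contra hcon
    simp only [Set.mem_union, Set.mem_iUnion, not_or, not_exists, Set.mem_preimage,
      Set.mem_symmDiff] at hcon
    refine hcon.1 fun g hg => ?_
    have h1 := hx g hg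
    have h2 := hcon.2 g hg
    tauto
  refine (measure_mono hsub).trans ((measure_union_le _ _).trans ?_)
  gcongr
  refine (measure_biUnion_finset_le _ _).trans ?_
  calc _ ≤ ∑ _g ∈ F, (edist A B + edist A B) := by
        refine Finset.sum_le_sum fun g _ => (measure_union_le _ _).trans ?_
        rw [hpre, hpre]
    _ = _ := by
        rw [Finset.sum_const, nsmul_eq_mul, ← two_mul]
        push_cast
        ring

theorem isOpen_setOf_measure_agreementSet_lt (hμ : IsPMPAction G μ) (h : G) (ε : ℝ≥0∞) :
    IsOpen {A : MeasuredSets μ | ∃ F : Finset G,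
      μ (agreementSet (F : Set G) h (A : Set X)) < ε} := by
  rw [Set.ofPred_exists]
  refine isOpen_iUnion fun F => ?_
  have hc : Continuous fun A : MeasuredSets μ =>
      μ (agreementSet (F : Set G) h (A : Set X)) :=
    continuous_of_le_add_edist ((2 * F.card : ℕ) : ℝ≥0∞) (ENNReal.natCast_ne_top _)
      fun A B => measure_agreementSet_le hμ F h A B
  exact isOpen_lt hc continuous_const

end Agreement

/-! ### Density by random perturbation, and the category argument -/

section Perturbation

variable {G : Type u} [Group G] {X : Type v} [MulAction G X]

theorem card_filter_apply_eq_mul {ι α : Type*} [Fintype ι] [Fintype α] [DecidableEq ι]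
    [DecidableEq α] (i : ι) (a : α) :
    Nat.card {ω : ι → α | ω i = a} * Fintype.card α = Fintype.card α ^ Fintype.card ι := by
  classical
  have h := card_filter_comp_mem_mul (α := α) (u := fun _ : Unit => i)
    (Function.injective_of_subsingleton _) {σ | σ () = a}
  have h1 : Finset.card {σ : Unit → α | σ ∈ {σ : Unit → α | σ () = a}} = 1 := by
    refine Finset.card_eq_one.2 ⟨fun _ => a, ?_⟩
    ext σ
    simp [funext_iff, Unique.forall_iff]
  rw [h1, one_mul, Fintype.card_unit, pow_one] at h
  rw [← h, Nat.card_eq_fintype_card, Fintype.card_subtype]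
  rfl

/-- If the points `g • x` and `(g * h) • x`, `g ∈ F`, have different labels under `π`, then few
labellings `ω` are such that `A ∆ {ω ∘ π = 0}` distinguishes none of the pairs. -/
theorem card_mem_agreementSet_symmDiff_mul_le {ι : Type*} [Fintype ι] [DecidableEq ι] (m : ℕ)
    (π : X → ι) (F : Finset G) (h : G) (A : Set X) (x : X)
    (hx : Function.Injective fun p : F × Bool =>
      π ((if p.2 then (p.1 : G) else (p.1 : G) * h) • x)) :
    Nat.card {ω : ι → Fin (m + 2) |
        x ∈ agreementSet (F : Set G) h (A ∆ {y | ω (π y) = 0})} * ((m + 2) ^ 2) ^ F.card ≤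
      ((m + 2) ^ 2 - 1) ^ F.card * (m + 2) ^ Fintype.card ι := by
  classical
  let S : F → Set (Bool → Fin (m + 2)) := fun g =>
    {τ | Xor ((g : G) • x ∈ A) (τ true = 0) ↔ Xor (((g : G) * h) • x ∈ A) (τ false = 0)}
  -- If `A` already separates the pair, flip both points; otherwise flip exactly one. The latter
  -- needs a nonzero label, hence the alphabet size `m + 2`.
  have hS : ∀ g, S g ≠ Set.univ := by
    intro g
    rw [Set.ne_univ_iff_exists_notMem]
    have h10 : (1 : Fin (m + 2)) ≠ 0 := by simp
    by_cases h1 : (g : G) • x ∈ A <;> by_cases h2 : ((g : G) * h) • x ∈ A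
    · exact ⟨fun b => if b then 0 else 1, by simp [S, h1, h2, Xor]⟩
    · exact ⟨fun b => 0, by simp [S, h1, h2, Xor]⟩
    · exact ⟨fun b => 0, by simp [S, h1, h2, Xor]⟩
    · exact ⟨fun b => if b then 0 else 1, by simp [S, h1, h2, Xor]⟩
  have key := card_filter_forall_mem_mul_le hx S hS
  simp only [Fintype.card_fin, Fintype.card_bool, Fintype.card_coe] at key
  refine (le_of_eq ?_).trans key
  rw [Nat.card_eq_fintype_card, Fintype.card_subtype]
  congr 2
  ext ω
  simp only [Finset.mem_filter, Finset.mem_univ, true_and, Set.mem_ofPred_eq, agreementSet, S,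
    Set.mem_symmDiff, Subtype.forall, Finset.mem_coe, if_true, Bool.false_eq_true, if_false]
  rfl

variable [MeasurableSpace X] {μ : Measure X}

/-- For a free action, the first `n` bits of a measurable injection into the Cantor space separate
finitely many translates of most points, if `n` is large. -/
theorem exists_measureReal_not_injective_lt [Countable G] (hμ : IsPMPAction G μ)
    (hfree : IsFreeAction G X) {J : Type*} [Finite J] {t : J → G} (ht : Function.Injective t)
    {e : X → ℕ → Bool} (he : Measurable e) (hinj : Function.Injective e) {δ : ℝ} (hδ : 0 < δ) :
    ∃ n : ℕ, MeasurableSet {x | ¬ Function.Injective fun j (i : Fin n) => e (t j • x) i} ∧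
      μ.real {x | ¬ Function.Injective fun j (i : Fin n) => e (t j • x) i} < δ := by
  have := hμ.isProbabilityMeasure
  set E : ℕ → Set X := fun n => {x | ¬ Function.Injective fun j (i : Fin n) => e (t j • x) i}
  have hE : ∀ n, MeasurableSet (E n) := by
    intro n
    have : E n = ⋃ p : J × J, ⋃ _ : p.1 ≠ p.2, ⋂ i : Fin n,
        {x | e (t p.1 • x) i = e (t p.2 • x) i} := by
      ext x
      simp only [E, Set.mem_ofPred_eq, Function.Injective, Set.mem_iUnion, Set.mem_iInter,
        Prod.exists, funext_iff]
      push Not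
      exact ⟨fun ⟨a, b, h1, h2⟩ => ⟨a, b, h2, h1⟩, fun ⟨a, b, h1, h2⟩ => ⟨a, b, h2, h1⟩⟩
    rw [this]
    have hm : ∀ (j : J) (i : ℕ), Measurable fun x => e (t j • x) i := fun j i =>
      (measurable_pi_apply i).comp (he.comp (hμ.measurable_smul (t j)))
    exact MeasurableSet.iUnion fun p => MeasurableSet.iUnion fun _ => MeasurableSet.iInter
      fun i => measurableSet_eq_fun (hm _ _) (hm _ _)
  have hanti : Antitone E := by
    intro n n' hn x hx hinj'
    refine hx fun a b hab => hinj' ?_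
    funext i
    exact congrFun hab (Fin.castLE hn i)
  -- Freeness makes the translates of `x` distinct, so each pair differs at some bit, and finitely
  -- many pairs need only finitely many bits.
  have hempty : ⋂ n, E n = ∅ := by
    refine Set.eq_empty_of_forall_notMem fun x hx => ?_
    rw [Set.mem_iInter] at hx
    have hne : ∀ p : J × J, ∃ n, p.1 ≠ p.2 → e (t p.1 • x) n ≠ e (t p.2 • x) n := by
      intro p
      by_cases hp : p.1 = p.2
      · exact ⟨0, fun h => (h hp).elim⟩
      · have : e (t p.1 • x) ≠ e (t p.2 • x) := by
          intro h
          have h1 := hinj h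
          have h2 : ((t p.2)⁻¹ * t p.1) • x = x := by rw [mul_smul, h1, inv_smul_smul]
          exact hp (ht (inv_mul_eq_one.1 (hfree _ _ h2)).symm)
        obtain ⟨n, hn⟩ := Function.ne_iff.1 this
        exact ⟨n, fun _ => hn⟩
    choose k hk using hne
    obtain ⟨n, hn⟩ := (Set.finite_range k).bddAbove
    refine hx (n + 1) fun a b hab => ?_
    by_contra hne
    exact hk (a, b) hne (congrFun hab ⟨k (a, b), Nat.lt_succ_of_le (hn ⟨_, rfl⟩)⟩)
  have hlim := tendsto_measure_iInter_atTop (μ := μ) (fun n => (hE n).nullMeasurableSet) hanti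
    ⟨0, measure_ne_top _ _⟩
  rw [hempty, measure_empty] at hlim
  obtain ⟨n, hn⟩ := (hlim.eventually (gt_mem_nhds (ENNReal.ofReal_pos.2 hδ))).exists
  exact ⟨n, hE n, (ENNReal.lt_ofReal_iff_toReal_lt (measure_ne_top _ _)).1 hn⟩

/-- Flip `A` on a random union of cells of a fine finite partition, each cell chosen with
probability `1/N`. The expected change is at most `1/N`. Where the `2M` relevant points lie in
different cells, the `M` pairs are independent, and all go undetected with probability at most `(1 -
1/N²)^M`. The parameters `N`, `M` and the fineness `n` are chosen in this order, each costing `δ/3`.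
-/
theorem exists_symmDiff_lt_agreementSet_lt [Countable G] [Infinite G] (hμ : IsPMPAction G μ)
    (hfree : IsFreeAction G X) {h : G} (hh : h ≠ 1) {A : Set X} (hA : MeasurableSet A) {δ : ℝ}
    (hδ : 0 < δ) : ∃ (B : Set X) (F : Finset G), MeasurableSet B ∧ μ.real (A ∆ B) < δ ∧
      μ.real (agreementSet (F : Set G) h B) < δ := by
  classical
  have := hμ.isProbabilityMeasure
  have := hμ.standardBorel
  obtain ⟨e, he, hinj⟩ := MeasurableSpace.measurable_injection_nat_bool_of_countablySeparated X
  obtain ⟨m, hm⟩ := exists_nat_one_div_lt (show 0 < δ / 3 by positivity)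
  set N : ℝ := m + 2 with hN
  have hN2 : 2 ≤ N := by simp [hN]
  have hr0 : 0 ≤ (N ^ 2 - 1) / N ^ 2 := div_nonneg (by nlinarith) (by positivity)
  have hr1 : (N ^ 2 - 1) / N ^ 2 < 1 := by rw [div_lt_one (by positivity)]; linarith
  obtain ⟨M, hM⟩ := exists_pow_lt_of_lt_one (show 0 < δ / 3 by positivity) hr1
  obtain ⟨F, hFM, hF⟩ := exists_finset_card_eq_forall_ne_mul hh M
  let t : F × Bool → G := fun p => if p.2 then (p.1 : G) else (p.1 : G) * h
  have ht : Function.Injective t := by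
    rintro ⟨⟨a, ha⟩, b⟩ ⟨⟨a', ha'⟩, b'⟩ hab
    cases b <;> cases b' <;> simp only [t, if_true, Bool.false_eq_true, if_false] at hab
    · simpa using hab
    · exact (hF _ ha' _ ha hab.symm).elim
    · exact (hF _ ha _ ha' hab).elim
    · simpa using hab
  obtain ⟨n, hEm, hE⟩ := exists_measureReal_not_injective_lt hμ hfree ht he hinj
    (show 0 < δ / 3 by positivity)
  set E := {x | ¬ Function.Injective fun j (i : Fin n) => e (t j • x) i}
  let π : X → Fin n → Bool := fun x i => e x i
  have hπ : Measurable π := measurable_pi_lambda _ fun i => (measurable_pi_apply _).comp he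
  let T : ((Fin n → Bool) → Fin (m + 2)) → Set X := fun ω => {y | ω (π y) = 0}
  have hT : ∀ ω, MeasurableSet (T ω) := fun ω =>
    hπ (MeasurableSet.of_discrete (s := {c | ω c = 0}))
  set K : ℝ := ((Fintype.card ((Fin n → Bool) → Fin (m + 2)) : ℕ) : ℝ) with hK
  have hKN : K = N ^ Fintype.card (Fin n → Bool) := by
    rw [hK, hN, Fintype.card_fun, Fintype.card_fin]; push_cast; rfl
  have hKpos : 0 < K := by rw [hKN]; positivity
  have h1 : ∑ ω, μ.real (T ω) ≤ K / N := by
    have := sum_measureReal_le_of_card_le μ hT MeasurableSet.empty (c := K / N) (by positivity)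
      fun x _ => ?_
    · simpa using this
    · have h := card_filter_apply_eq_mul (π x) (0 : Fin (m + 2))
      rw [le_div_iff₀ (by positivity), hKN, hN]
      rw [Fintype.card_fin] at h
      exact_mod_cast h.le
  have h2 : ∑ ω, μ.real (agreementSet (F : Set G) h (A ∆ T ω)) ≤
      ((N ^ 2 - 1) / N ^ 2) ^ M * K + K * μ.real E := by
    refine sum_measureReal_le_of_card_le μ
      (fun ω => measurableSet_agreementSet hμ _ h (hA.symmDiff (hT ω))) hEm (by positivity)
      fun x hx => ?_
    have h := card_mem_agreementSet_symmDiff_mul_le m π F h A x (not_not.1 hx)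
    rw [hFM] at h
    rw [div_pow, div_mul_eq_mul_div, le_div_iff₀ (by positivity), hKN, hN]
    have hcast : (((m + 2) ^ 2 - 1 : ℕ) : ℝ) = ((m : ℝ) + 2) ^ 2 - 1 := by
      rw [Nat.cast_sub (Nat.one_le_pow _ _ (by omega))]; push_cast; rfl
    rw [← hcast]
    exact_mod_cast h
  have hlt : ∑ ω, (μ.real (T ω) + μ.real (agreementSet (F : Set G) h (A ∆ T ω))) <
      ∑ _ω : (Fin n → Bool) → Fin (m + 2), δ := by
    rw [Finset.sum_add_distrib, Finset.sum_const, Finset.card_univ, nsmul_eq_mul, ← hK]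
    have hb1 : K / N ≤ K * (δ / 3) := by
      rw [div_eq_mul_one_div]
      refine mul_le_mul_of_nonneg_left (le_trans ?_ hm.le) hKpos.le
      exact one_div_le_one_div_of_le (by positivity) (by linarith)
    have hb2 : ((N ^ 2 - 1) / N ^ 2) ^ M * K ≤ K * (δ / 3) := by
      rw [mul_comm]; gcongr
    have hb3 : K * μ.real E < K * (δ / 3) := by gcongr
    linarith
  obtain ⟨ω, -, hω⟩ := Finset.exists_lt_of_sum_lt hlt
  have hp1 : 0 ≤ μ.real (T ω) := measureReal_nonneg
  have hp2 : 0 ≤ μ.real (agreementSet (F : Set G) h (A ∆ T ω)) := measureReal_nonneg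
  refine ⟨A ∆ T ω, F, hA.symmDiff (hT ω), ?_, by linarith⟩
  rw [symmDiff_symmDiff_cancel_left]
  linarith

/-- Every free p.m.p. action of a countably infinite group has arbitrarily small measurable sets
whose itineraries are almost surely free. -/
theorem exists_measurableSet_lt_forall_agreementSet_eq_zero [Countable G] [Infinite G]
    (hμ : IsPMPAction G μ) (hfree : IsFreeAction G X) {δ : ℝ} (hδ : 0 < δ) :
    ∃ A : Set X, MeasurableSet A ∧ μ.real A < δ ∧
      ∀ h : G, h ≠ 1 → μ (agreementSet Set.univ h A) = 0 := by
  have := hμ.isProbabilityMeasure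
  let U : {h : G // h ≠ 1} × ℕ → Set (MeasuredSets μ) := fun p =>
    {A | ∃ F : Finset G, μ (agreementSet (F : Set G) p.1 (A : Set X)) < ((p.2 : ℝ≥0∞) + 1)⁻¹}
  have hdense : Dense (⋂ p, U p) := by
    refine dense_iInter_of_isOpen
      (fun p => isOpen_setOf_measure_agreementSet_lt hμ _ _) fun p => ?_
    rw [Metric.dense_iff]
    intro A r hr
    have hs : (0 : ℝ) < ((p.2 : ℝ) + 1)⁻¹ := by positivity
    obtain ⟨B, F, hB, h1, h2⟩ :=
      exists_symmDiff_lt_agreementSet_lt hμ hfree p.1.2 A.2 (lt_min hr hs)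
    let B' : MeasuredSets μ := ⟨B, hB⟩
    refine ⟨B', ?_, F, ?_⟩
    · rw [Metric.mem_ball, dist_comm]
      exact h1.trans_le (min_le_left _ _)
    · have h3 := (ENNReal.lt_ofReal_iff_toReal_lt (measure_ne_top _ _)).2
        (h2.trans_le (min_le_right _ _))
      rwa [ENNReal.ofReal_inv_of_pos (by positivity), ENNReal.ofReal_add (by positivity) (by simp),
        ENNReal.ofReal_natCast, ENNReal.ofReal_one] at h3
  -- Distance to the empty set is measure, so density near it yields smallness.
  let O : MeasuredSets μ := ⟨∅, MeasurableSet.empty⟩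
  obtain ⟨A, hA, hAU⟩ := hdense.exists_dist_lt O hδ
  refine ⟨A, A.2, ?_, fun h hh => ?_⟩
  · have h0 : dist O A = μ.real (A : Set X) := congrArg μ.real (bot_symmDiff (A : Set X))
    rwa [h0] at hAU
  · refine le_antisymm (ENNReal.le_of_forall_pos_le_add fun ε hε _ => ?_) zero_le
    obtain ⟨n, hn⟩ := ENNReal.exists_inv_nat_lt (ENNReal.coe_ne_zero.2 hε.ne')
    obtain ⟨F, hF⟩ := Set.mem_iInter.1 hA (⟨h, hh⟩, n)
    rw [zero_add]
    have hsub : agreementSet Set.univ h (A : Set X) ⊆ agreementSet (F : Set G) h (A : Set X) :=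
      fun x hx g _ => hx g trivial
    refine (measure_mono hsub).trans (hF.le.trans (le_trans ?_ hn.le))
    exact ENNReal.inv_le_inv.2 le_self_add

end Perturbation

/-! ### The free shift and its two-symbol generator -/

/-- The free part of the shift of `G` on `G → K`. -/
abbrev FreeShift (G : Type u) [Group G] (K : Type v) : Type (max u v) :=
  {z : G → K // ∀ h : G, (∀ g, z (g * h) = z g) → h = 1}

namespace FreeShift

variable {G : Type u} [Group G] {K : Type v}

theorem ext {z w : FreeShift G K} (h : ∀ g, z.1 g = w.1 g) : z = w := Subtype.ext (funext h)

instance : MulAction G (FreeShift G K) where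
  smul k z := ⟨fun g => z.1 (g * k), fun h hh => by
    -- Translating by `k` conjugates the stabilizer, so freeness is preserved.
    have : k⁻¹ * h * k = 1 := z.2 _ fun g => by
      have := hh (g * k⁻¹)
      simpa [mul_assoc] using this
    rwa [mul_assoc, inv_mul_eq_one, eq_comm, mul_eq_right] at this⟩
  one_smul z := FreeShift.ext fun g => congrArg z.1 (mul_one g)
  mul_smul k l z := FreeShift.ext fun g => congrArg z.1 (mul_assoc g k l).symm

@[simp]
theorem smul_apply (k : G) (z : FreeShift G K) (g : G) : (k • z).1 g = z.1 (g * k) := rfl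

theorem isFreeAction : IsFreeAction G (FreeShift G K) := fun h z hz =>
  z.2 h fun g => congrFun (congrArg Subtype.val hz) g

variable [MeasurableSpace K]

theorem measurable_val : Measurable (Subtype.val : FreeShift G K → G → K) := measurable_subtype_coe

theorem measurable_apply (g : G) : Measurable fun z : FreeShift G K => z.1 g :=
  (measurable_pi_apply g).comp measurable_val

theorem measurable_smul (k : G) : Measurable fun z : FreeShift G K => k • z :=
  Measurable.subtype_mk (measurable_pi_lambda _ fun g => measurable_apply (g * k))

theorem standardBorelSpace [Countable G] [StandardBorelSpace K] :
    StandardBorelSpace (FreeShift G K) := by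
  refine MeasurableSet.standardBorel (s := {z : G → K | ∀ h : G, (∀ g, z (g * h) = z g) → h = 1}) ?_
  simp only [Set.ofPred_forall]
  refine MeasurableSet.iInter fun h => MeasurableSet.imp ?_ (MeasurableSet.const _)
  simp only [Set.ofPred_forall]
  exact MeasurableSet.iInter fun g =>
    measurableSet_eq_fun (measurable_pi_apply _) (measurable_pi_apply _)

/-- The configurations taking only the values `a` and `b`. -/
def binary (G : Type u) [Group G] {K : Type v} (a b : K) : SubMulAction G (FreeShift G K) where
  carrier := {z | ∀ g, z.1 g = a ∨ z.1 g = b}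
  smul_mem' k _ hz g := hz (g * k)

theorem measurableSet_binary [Countable G] [MeasurableSingletonClass K] (a b : K) :
    MeasurableSet (binary G a b : Set (FreeShift G K)) := by
  have : (binary G a b : Set (FreeShift G K)) = ⋂ g, {z | z.1 g ∈ ({a, b} : Set K)} := by
    ext z; rw [Set.mem_iInter]; rfl
  rw [this]
  exact MeasurableSet.iInter fun g => measurable_apply g (Set.toFinite _).measurableSet

/-- The coordinate of `w` at `g` is the identity coordinate of `g • w`. As only two values occur,
translates of one piece determine every coordinate. -/
theorem invariantSigmaAlgebra_binary [MeasurableSingletonClass K] (a b : K) :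
    invariantSigmaAlgebra G (restrictPartition ({{z | z.1 1 = a}ᶜ, {z | z.1 1 = a}} : Set (Set _))
      (binary G a b : Set (FreeShift G K))) =
      (inferInstance : MeasurableSpace (binary G a b)) := by
  classical
  have hC : MeasurableSet {z : FreeShift G K | z.1 1 = a} :=
    measurable_apply 1 (measurableSet_singleton a)
  refine le_antisymm (sInf_le ⟨?_, ?_⟩) (le_sInf fun m hm => ?_)
  · rintro _ ⟨-, A, hA | hA, rfl⟩
    · rw [hA]; exact measurable_subtype_coe hC.compl
    · rw [hA]; exact measurable_subtype_coe hC
  · intro g A hA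
    exact (Measurable.subtype_mk ((measurable_smul g).comp measurable_subtype_coe)) hA
  · have hval : @Measurable _ _ m _ fun w : binary G a b => w.1.1 := by
      refine @measurable_pi_lambda _ _ _ m _ _ fun g => ?_
      have hset : MeasurableSet[m] {w : binary G a b | (g • w).1.1 1 = a} := by
        refine hm.2 g (Subtype.val ⁻¹' {z : FreeShift G K | z.1 1 = a}) ?_
        -- Empty traces are not in the restricted partition, so they are handled separately.
        rcases (Subtype.val ⁻¹' {z : FreeShift G K | z.1 1 = a} :
          Set (binary G a b)).eq_empty_or_nonempty with h | h
        · exact (congrArg (fun A => MeasurableSet[m] A) h).mpr (@MeasurableSet.empty _ m)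
        · exact hm.1 _ ⟨h, _, Or.inr rfl, rfl⟩
      have heq : (fun w : binary G a b => w.1.1 g) =
          fun w => if w ∈ {w : binary G a b | (g • w).1.1 1 = a} then a else b := by
        funext w
        have h1 : (g • w).1.1 1 = w.1.1 g := congrArg w.1.1 (one_mul g)
        simp only [Set.mem_ofPred_eq, h1]
        split_ifs with h
        · exact h
        · exact (w.2 g).resolve_left h
      refine (congrArg (fun φ => @Measurable _ _ m _ φ) heq).mpr ?_
      have hconst : ∀ k : K, @Measurable (binary G a b) K m _ fun _ => k := fun _ =>
        @measurable_const _ _ _ m _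
      exact Measurable.ite hset (hconst a) (hconst b)
    exact MeasurableSpace.comap_comp.le.trans hval.comap_le

theorem isMeasureGeneratingPartition [Countable G] [Nontrivial G] [MeasurableSingletonClass K]
    {a b : K} (hab : a ≠ b) {η : Measure (FreeShift G K)} [IsProbabilityMeasure η]
    (hη : η (binary G a b : Set (FreeShift G K))ᶜ = 0) :
    IsMeasureGeneratingPartition G η {{z | z.1 1 = a}ᶜ, {z | z.1 1 = a}} := by
  set C : Set (FreeShift G K) := {z | z.1 1 = a} with hCdef
  have hC : MeasurableSet C := measurable_apply 1 (measurableSet_singleton a)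
  -- A binary configuration with trivial stabilizer is not constant, so its translates meet both
  -- pieces.
  have hCne : C.Nonempty ∧ Cᶜ.Nonempty := by
    have hne : (binary G a b : Set (FreeShift G K)).Nonempty := by
      by_contra h
      rw [Set.not_nonempty_iff_eq_empty] at h
      rw [h, Set.compl_empty, measure_univ] at hη
      exact one_ne_zero hη
    obtain ⟨z, hz⟩ := hne
    obtain ⟨h, hh⟩ := exists_ne (1 : G)
    have hex : ∃ g, z.1 (g * h) ≠ z.1 g := by
      by_contra! hcon
      exact hh (z.2 h hcon)
    obtain ⟨g, hg⟩ := hex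
    have hmem : ∀ k, z.1 k = a → k • z ∈ C := fun k hk => by simpa [hCdef] using hk
    have hnmem : ∀ k, z.1 k = b → k • z ∈ Cᶜ := fun k hk => by
      simpa [hCdef, hk] using hab.symm
    rcases hz g with h1 | h1 <;> rcases hz (g * h) with h2 | h2
    · exact (hg (h2.trans h1.symm)).elim
    · exact ⟨⟨_, hmem _ h1⟩, ⟨_, hnmem _ h2⟩⟩
    · exact ⟨⟨_, hmem _ h2⟩, ⟨_, hnmem _ h1⟩⟩
    · exact (hg (h2.trans h1.symm)).elim
  refine ⟨⟨Set.toFinite _ |>.countable, ?_, ?_, ?_⟩, binary G a b, measurableSet_binary a b, hη,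
    ⟨?_, ?_, ?_, ?_⟩, invariantSigmaAlgebra_binary a b⟩
  · rintro A (rfl | rfl)
    exacts [hC.compl, hC]
  · rintro (h | h)
    · exact hCne.2.ne_empty h.symm
    · exact hCne.1.ne_empty h.symm
  · intro z
    by_cases hz : z ∈ C
    · refine ⟨C, ⟨Or.inr rfl, hz⟩, ?_⟩
      rintro B ⟨rfl | rfl, hB⟩
      exacts [(hB hz).elim, rfl]
    · refine ⟨Cᶜ, ⟨Or.inl rfl, hz⟩, ?_⟩
      rintro B ⟨rfl | rfl, hB⟩
      exacts [rfl, (hz hB).elim]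
  · refine ((Set.toFinite {Cᶜ, C}).image
      fun A => (Subtype.val ⁻¹' A : Set (binary G a b))).countable.mono ?_
    rintro _ ⟨-, A, hA, rfl⟩
    exact ⟨A, hA, rfl⟩
  · rintro _ ⟨-, A, rfl | rfl, rfl⟩
    exacts [measurable_subtype_coe hC.compl, measurable_subtype_coe hC]
  · exact fun h => h.1.ne_empty rfl
  · intro z
    by_cases hz : z.1 ∈ C
    · refine ⟨Subtype.val ⁻¹' C, ⟨⟨⟨z, hz⟩, C, Or.inr rfl, rfl⟩, hz⟩, ?_⟩
      rintro _ ⟨⟨-, A, rfl | rfl, rfl⟩, hB⟩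
      exacts [(hB hz).elim, rfl]
    · refine ⟨Subtype.val ⁻¹' Cᶜ, ⟨⟨⟨z, hz⟩, Cᶜ, Or.inl rfl, rfl⟩, hz⟩, ?_⟩
      rintro _ ⟨⟨-, A, rfl | rfl, rfl⟩, hB⟩
      exacts [rfl, (hz hB).elim]

end FreeShift

/-! ### Small entropy and construction of the factor -/

theorem exists_forall_shannonEntropy_compl_pair_lt {ε : ℝ} (hε : 0 < ε) :
    ∃ δ > 0, ∀ {Z : Type u} [MeasurableSpace Z] (η : Measure Z) [IsProbabilityMeasure η]
      {C : Set Z}, MeasurableSet C → Cᶜ ≠ C → η.real C < δ →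
      shannonEntropy η {Cᶜ, C} < ENNReal.ofReal ε := by
  classical
  have hcont : Continuous fun p : ℝ => Real.negMulLog (1 - p) + Real.negMulLog p :=
    (Real.continuous_negMulLog.comp (continuous_const.sub continuous_id)).add
      Real.continuous_negMulLog
  obtain ⟨δ, hδ, h⟩ := Metric.continuousAt_iff.1 (hcont.continuousAt (x := 0)) ε hε
  refine ⟨δ, hδ, fun {Z} _ η _ C hC hne hlt => ?_⟩
  have hp : 0 ≤ η.real C := measureReal_nonneg
  have hp1 : η.real C ≤ 1 := measureReal_le_one
  have h1 := h (x := η.real C) (by rwa [Real.dist_0_eq_abs, abs_of_nonneg hp])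
  simp only [sub_zero, Real.negMulLog_one, Real.negMulLog_zero, add_zero, Real.dist_0_eq_abs] at h1
  rw [shannonEntropy, ← Finset.coe_pair,
    Finset.tsum_subtype' _ fun A : Set Z => ENNReal.ofReal (Real.negMulLog (η.real A)),
    Finset.sum_pair hne, measureReal_compl hC, probReal_univ,
    ← ENNReal.ofReal_add (Real.negMulLog_nonneg (by linarith) (by linarith))
      (Real.negMulLog_nonneg hp hp1)]
  exact (ENNReal.ofReal_lt_ofReal_iff hε).2 ((le_abs_self _).trans_lt h1)

/-- An action with an almost surely free itinerary of a set `A` maps equivariantly to the free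
shift over the Cantor space; on almost every point the map records the visits to `A`. -/
theorem exists_equivariant_freeShift {G : Type u} [Group G] [Countable G] {X : Type v}
    [MeasurableSpace X] [MulAction G X] {μ : Measure X} (hμ : IsPMPAction G μ)
    (hfree : IsFreeAction G X) {A : Set X} (hA : MeasurableSet A)
    (hAfree : ∀ h : G, h ≠ 1 → μ (agreementSet Set.univ h A) = 0) :
    ∃ f : X → FreeShift G (ℕ → Bool), Measurable f ∧ (∀ (g : G) (x : X), f (g • x) = g • f x) ∧
      ∀ᵐ x ∂μ, ∀ g : G, (g • x ∈ A → (f x).1 g = fun _ => true) ∧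
        (g • x ∉ A → (f x).1 g = fun _ => false) := by
  classical
  have := hμ.standardBorel
  obtain ⟨e, he, hinj⟩ := MeasurableSpace.measurable_injection_nat_bool_of_countablySeparated X
  let W : Set X := {x | ∀ h : G, h ≠ 1 → x ∉ agreementSet Set.univ h A}
  have hW : W = ⋂ (h : G) (_ : h ≠ 1), (agreementSet Set.univ h A)ᶜ := by
    ext x; simp [W]
  have hWm : MeasurableSet W := by
    rw [hW]
    exact MeasurableSet.iInter fun h => MeasurableSet.iInter fun _ =>
      (measurableSet_agreementSet hμ _ h hA).compl
  have hWae : ∀ᵐ x ∂μ, x ∈ W := by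
    refine ae_all_iff.2 fun h => ?_
    by_cases hh : h = 1
    · simp [hh]
    · exact (measure_eq_zero_iff_ae_notMem.1 (hAfree h hh)).mono fun x hx _ => hx
  -- If `h` fixes the itinerary of `k • x`, then `k⁻¹ * h * k` fixes that of `x`.
  have hWsmul : ∀ (k : G) (x : X), x ∈ W → k • x ∈ W := by
    intro k x hx h hh hk
    refine hx (k⁻¹ * h * k) (fun h1 => hh ?_) fun g _ => ?_
    · have h2 : h = k * (k⁻¹ * h * k) * k⁻¹ := by group
      rw [h2, h1]; simp
    · have := hk (g * k⁻¹) trivial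
      simpa [← mul_smul, mul_assoc] using this
  have hWiff : ∀ (k : G) (x : X), k • x ∈ W ↔ x ∈ W := fun k x =>
    ⟨fun hx => by simpa using hWsmul k⁻¹ _ hx, hWsmul k x⟩
  -- Off the invariant conull set `W`, the injective coding `e` replaces the visits to `A`, so the
  -- map is equivariant and lands in the free part at every point. The Cantor alphabet accommodates
  -- both codings.
  let c : X → G → ℕ → Bool := fun x g =>
    if x ∈ W then (if g • x ∈ A then fun _ => true else fun _ => false) else e (g • x)
  have htf : (fun _ : ℕ => true) ≠ fun _ => false := fun h => by simpa using congrFun h 0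
  have hc : ∀ x h, (∀ g, c x (g * h) = c x g) → h = 1 := by
    intro x h hh
    by_cases hx : x ∈ W
    · by_contra h1
      refine hx h h1 fun g _ => ?_
      have := hh g
      simp only [c, if_pos hx] at this
      split_ifs at this with h2 h3 h3
      · exact iff_of_true h3 h2
      · exact (htf this).elim
      · exact (htf this.symm).elim
      · exact iff_of_false h3 h2
    · have := hh 1
      simp only [c, if_neg hx, one_mul, one_smul] at this
      exact hfree h x (hinj this)
  refine ⟨fun x => ⟨c x, hc x⟩, ?_, ?_, ?_⟩
  · refine Measurable.subtype_mk (measurable_pi_lambda _ fun g => ?_)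
    exact Measurable.ite hWm
      (Measurable.ite (hμ.measurable_smul g hA) measurable_const measurable_const)
      (he.comp (hμ.measurable_smul g))
  · intro k x
    refine FreeShift.ext fun g => ?_
    simp only [FreeShift.smul_apply, c, hWiff, mul_smul]
  · filter_upwards [hWae] with x hx g
    exact ⟨fun h => by simp [c, hx, h], fun h => by simp [c, hx, h]⟩

theorem corollary2p6 {G : Type u} [Group G] [Countable G] [Infinite G]
    {X : Type v} [MeasurableSpace X] [MulAction G X] (μ : Measure X)
    (hμ : IsPMPAction G μ) (hfree : IsFreeAction G X) (ε : ℝ) (hε : 0 < ε) :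
    ∃ (Z : Type u) (_ : MeasurableSpace Z) (_ : MulAction G Z) (η : Measure Z) (f : X → Z),
      IsPMPAction G η ∧ IsFreeAction G Z ∧ IsFactorMap G μ η f ∧
      ∃ C₀ C₁ : Set Z, C₀ ≠ C₁ ∧ IsMeasureGeneratingPartition G η {C₀, C₁} ∧
        shannonEntropy η {C₀, C₁} < ENNReal.ofReal ε := by
  have := hμ.isProbabilityMeasure
  obtain ⟨δ, hδ, hent⟩ := exists_forall_shannonEntropy_compl_pair_lt.{u} hε
  obtain ⟨A, hA, hAδ, hAfree⟩ :=
    exists_measurableSet_lt_forall_agreementSet_eq_zero hμ hfree hδ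
  obtain ⟨f, hf, hequiv, hfA⟩ := exists_equivariant_freeShift hμ hfree hA hAfree
  have htf : (fun _ : ℕ => true) ≠ fun _ => false := fun h => by simpa using congrFun h 0
  set C : Set (FreeShift G (ℕ → Bool)) := {z | z.1 1 = fun _ => true} with hCdef
  have hC : MeasurableSet C := FreeShift.measurable_apply 1 (measurableSet_singleton _)
  have hη : IsProbabilityMeasure (μ.map f) := Measure.isProbabilityMeasure_map hf.aemeasurable
  have hne : Cᶜ ≠ C := by
    have : Nonempty X := nonempty_of_isProbabilityMeasure μ
    have : Nonempty (FreeShift G (ℕ → Bool)) := this.map f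
    exact compl_ne_self
  refine ⟨FreeShift G (ℕ → Bool), inferInstance, inferInstance, μ.map f, f,
    ⟨FreeShift.standardBorelSpace, FreeShift.measurable_smul, hη, fun g =>
      ⟨FreeShift.measurable_smul g, ?_⟩⟩, FreeShift.isFreeAction, ⟨hf, hequiv, rfl⟩,
    Cᶜ, C, hne, FreeShift.isMeasureGeneratingPartition htf ?_, hent _ hC hne ?_⟩
  · rw [Measure.map_map (FreeShift.measurable_smul g) hf]
    have hcomp : (fun z : FreeShift G (ℕ → Bool) => g • z) ∘ f = f ∘ fun x => g • x :=
      funext fun x => (hequiv g x).symm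
    rw [hcomp, ← Measure.map_map hf (hμ.measurable_smul g), (hμ.measure_preserving g).map_eq]
  · rw [Measure.map_apply hf (FreeShift.measurableSet_binary _ _).compl]
    refine measure_eq_zero_iff_ae_notMem.2 ?_
    filter_upwards [hfA] with x hx hmem
    refine hmem fun g => ?_
    by_cases hg : g • x ∈ A
    · exact Or.inl ((hx g).1 hg)
    · exact Or.inr ((hx g).2 hg)
  -- Reading the itinerary at the identity shows that `f ⁻¹' C` lies in `A` up to a null set.
  · rw [measureReal_def, Measure.map_apply hf hC, ← measureReal_def]
    refine lt_of_le_of_lt (ENNReal.toReal_mono (measure_ne_top _ _) (measure_mono_ae ?_)) hAδ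
    filter_upwards [hfA] with x hx hmem
    by_contra hg
    have h1 := (hx 1).2 (by rwa [one_smul])
    exact htf ((show (f x).1 1 = fun _ => true from hmem).symm.trans h1)
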